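/- \textbf{Theorem (Dynamic completeness).} Let $\mathsf{Ag}$ be a finite nonempty set of agents, $\mathsf{At}$ a countable set of atoms and $\mathbf{O}$ a countable nonempty set of objects. \emph{Models.} An $\mathbf{O}$-model is $\mathcal M=(\mathcal W,\mathcal R,\mathcal O,\mathcal V)$ with $\mathcal W\neq\emptyset$, $\mathcal R_i\subseteq \mathcal W\times\mathcal W$ and $\mathcal O_i:\mathcal W\to\wp(\mathbf O)$ for $i\in\mathsf{Ag}$, and $\mathcal V:\mathsf{At}\to\wp(\mathcal W)$. The static language $\mathcal L$ is $\varphi::=\top\mid p\mid \mathrm O_i o\mid\neg\varphi\mid\varphi\wedge\varphi\mid\square_i\varphi$, with $\mathcal M,w\models \mathrm O_i o$ iff $o\in\mathcal O_i(w)$ and the usual clauses otherwise. \emph{Event models.} An event $\mathbf O$-model is $\mathcal E=(\mathcal S,\mathcal T,\mathsf{pre},\mathsf{eff})$ with $\mathcal S$ finite and nonempty, $\mathcal T_i\subseteq\mathcal S\times\mathcal S$, $\mathsf{pre}:\mathcal S\to\mathcal L$, and finite disjoint sets $\mathsf{eff}^+_i(s),\mathsf{eff}^-_i(s)\subseteq\mathbf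 O$ for all $i\in\mathsf{Ag}$, $s\in\mathcal S$. The product update $\mathcal M\otimes\mathcal E$ has worlds $\{(w,s):\mathcal M,w\models\mathsf{pre}(s)\}$ (it is defined only if this set is nonempty), relations $(w,s)\mathcal R'_i(u,t)$ iff $w\mathcal R_iu$ and $s\mathcal T_it$, objects $\mathcal O'_i(w,s)=(\mathcal O_i(w)\cup\mathsf{eff}^+_i(s))\setminus\mathsf{eff}^-_i(s)$, and valuation inherited from $\mathcal M$. For a class $\star$ of event $\mathbf O$-models, $\mathcal L(\star)$ extends the grammar of $\mathcal L$ by $[\mathcal E,s]\varphi$ ($\mathcal E\in\star$, $s\in\mathcal S$), where $\mathcal M,w\models[\mathcal E,s]\varphi$ iff $\mathcal M,w\models\mathsf{pre}(s)$ implies $\mathcal M\otimes\mathcal E,(w,s)\models\varphi$. \emph{Group properties.} Let $f$ be a possibly partial function from $\mathsf{Ag}$ to $\wp(\mathsf{Ag})\setminus\{\emptyset\}$ with nonempty domain. A model $f$-satisfies a group property $\mathbb P$ iff for all $i\in \mathrm{Dom}(f)$ and all $w\mathcal R_iu$ the condition (a) below holds; an event model $f$-satisfies $\mathsf{EMP}(\mathbb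 P)$ iff for all $i\in \mathrm{Dom}(f)$ and all $s\mathcal T_it$ the condition (b) holds; $\Gamma(\mathbb P^f)$ is the set of all instances of the schema (c), for $i\in \mathrm{Dom}(f)$ and $o\in\mathbf O$. Here $j$ ranges over $f(i)$ in $\bigcap,\bigcup,\bigwedge,\bigvee$. \begin{itemize} \item Preservation for all: (a) $\mathcal O_i(w)\subseteq\bigcap\mathcal O_j(u)$; (b) $\mathsf{eff}^+_i(s)\subseteq\bigcap\mathsf{eff}^+_j(t)$ and $\bigcup\mathsf{eff}^-_j(t)\subseteq\mathsf{eff}^-_i(s)$; (c) $\mathrm O_io\to\square_i\bigwedge\mathrm O_jo$. \item Preservation for some: (a) $\mathcal O_i(w)\subseteq\bigcup\mathcal O_j(u)$; (b) $\mathsf{eff}^+_i(s)\subseteq\bigcup\mathsf{eff}^+_j(t)$ and $\bigcup\mathsf{eff}^-_j(t)\subseteq\mathsf{eff}^-_i(s)$; (c) $\mathrm O_io\to\square_i\bigvee\mathrm O_jo$. \item Anti-preservation for all: (a) $\bigcup\mathcal O_j(u)\subseteq\mathcal O_i(w)$; (b) $\bigcup\mathsf{eff}^+_j(t)\subseteq\mathsf{eff}^+_i(s)$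 and $\mathsf{eff}^-_i(s)\subseteq\bigcap\mathsf{eff}^-_j(t)$; (c) $\neg\mathrm O_io\to\square_i\bigwedge\neg\mathrm O_jo$. \item Anti-preservation for some: (a) $\bigcap\mathcal O_j(u)\subseteq\mathcal O_i(w)$; (b) $\bigcup\mathsf{eff}^+_j(t)\subseteq\mathsf{eff}^+_i(s)$ and $\mathsf{eff}^-_i(s)\subseteq\bigcup\mathsf{eff}^-_j(t)$; (c) $\neg\mathrm O_io\to\square_i\bigvee\neg\mathrm O_jo$. \item Inversion for all: (a) $\mathcal O_i(w)\cap\bigcup\mathcal O_j(u)=\emptyset$; (b) $\mathsf{eff}^+_i(s)\subseteq\bigcap\mathsf{eff}^-_j(t)$ and $\bigcup\mathsf{eff}^+_j(t)\subseteq\mathsf{eff}^-_i(s)$; (c) $\mathrm O_io\to\square_i\bigwedge\neg\mathrm O_jo$. \item Inversion for some: (a) $\mathcal O_i(w)\cap\bigcap\mathcal O_j(u)=\emptyset$; (b) $\mathsf{eff}^+_i(s)\subseteq\bigcup\mathsf{eff}^-_j(t)$ and $\bigcup\mathsf{eff}^+_j(t)\subseteq\mathsf{eff}^-_i(s)$;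 (c) $\mathrm O_io\to\square_i\bigvee\neg\mathrm O_jo$. \item Anti-inversion for all: (a) $\mathcal O_i(w)\cup\bigcap\mathcal O_j(u)=\mathbf O$; (b) $\mathsf{eff}^-_i(s)\subseteq\bigcap\mathsf{eff}^+_j(t)$ and $\bigcup\mathsf{eff}^-_j(t)\subseteq\mathsf{eff}^+_i(s)$; (c) $\neg\mathrm O_io\to\square_i\bigwedge\mathrm O_jo$. \item Anti-inversion for some: (a) $\mathcal O_i(w)\cup\bigcup\mathcal O_j(u)=\mathbf O$; (b) $\mathsf{eff}^-_i(s)\subseteq\bigcup\mathsf{eff}^+_j(t)$ and $\bigcup\mathsf{eff}^-_j(t)\subseteq\mathsf{eff}^+_i(s)$; (c) $\neg\mathrm O_io\to\square_i\bigvee\mathrm O_jo$. \end{itemize} \emph{The logic.} Let $n\ge 0$, let $f_1,\dots,f_n$ be functions as above and $\mathbb P_1,\dots,\mathbb P_n$ group properties. Let $\mathfrak M$ be the class of $\mathbf O$-models that $f_k$-satisfy $\mathbb P_k$ for every $k$, and $\mathfrak E$ the class of event $\mathbf O$-models that $f_k$-satisfy $\mathsf{EMP}(\mathbb P_k)$ for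 every $k$. The logic $\mathsf L^!=\mathsf L^!(f_1\text{-}\mathbb P_1,\dots,f_n\text{-}\mathbb P_n)$ is the smallest set of formulas of $\mathcal L(\mathfrak E)$ that contains all propositional tautologies, all formulas $\square_i(\varphi\to\psi)\to(\square_i\varphi\to\square_i\psi)$, all formulas in $\bigcup_k\Gamma(\mathbb P_k^{f_k})$, and all instances of \begin{itemize} \item $[\mathcal E,s]\top\leftrightarrow\top$; \quad $[\mathcal E,s]p\leftrightarrow(\mathsf{pre}(s)\to p)$; \item $[\mathcal E,s]\mathrm O_ix\leftrightarrow(\mathsf{pre}(s)\to\mathrm O_ix)$ if $x\notin\mathsf{eff}^+_i(s)\cup\mathsf{eff}^-_i(s)$; \quad $[\mathcal E,s]\mathrm O_ix\leftrightarrow\top$ if $x\in\mathsf{eff}^+_i(s)$; \quad $[\mathcal E,s]\mathrm O_ix\leftrightarrow\neg\mathsf{pre}(s)$ if $x\in\mathsf{eff}^-_i(s)$; \item $[\mathcal E,s]\neg\varphi\leftrightarrow(\mathsf{pre}(s)\to\neg[\mathcal E,s]\varphi)$; \quad $[\mathcal E,s](\varphi\wedge\psi)\leftrightarrow([\mathcal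 E,s]\varphi\wedge[\mathcal E,s]\psi)$; \item $[\mathcal E,s]\square_i\varphi\leftrightarrow(\mathsf{pre}(s)\to\bigwedge_{s\mathcal T_it}\square_i[\mathcal E,t]\varphi)$, \end{itemize} and that is closed under modus ponens, necessitation for each $\square_i$, and the rule: from $\varphi\leftrightarrow\psi$ infer $\delta\leftrightarrow\delta'$, whenever $\delta'$ results from $\delta$ by replacing occurrences of $\varphi$ by $\psi$ (leaving the event models in dynamic modalities untouched). Write $\Phi\vdash\varphi$ if $(\psi_1\wedge\dots\wedge\psi_m)\to\varphi$ is in $\mathsf L^!$ for some $m\ge0$ and $\psi_1,\dots,\psi_m\in\Phi$, and $\Phi\models_{\mathfrak M}\varphi$ if $\varphi$ is true at every world of every model in $\mathfrak M$ at which all members of $\Phi$ are true. \emph{Claim.} $\mathsf L^!$ is sound and strongly complete with respect to $\mathfrak M$: every formula in $\mathsf L^!$ is true at every world of every model in $\mathfrak M$, and for every set $\Phi$ of formulas of $\mathcal L(\mathfrak E)$ and every formula $\varphi$ of $\mathcal L(\mathfrak E)$, $\Phi\vdash\varphi$ if and only if $\Phi\models_{\mathfrak M}\varphi$. -/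

import Mathlib

universe u

namespace OLogic

/-- An `O`-model: worlds, one accessibility relation and one object assignment per agent,
and an atomic valuation. -/
structure OModel (Ag At Ob : Type u) where
  W : Type u
  nonempty : Nonempty W
  R : Ag → W → W → Prop
  O : Ag → W → Set Ob
  V : At → Set W

/-- The static language `L`. -/
inductive Form (Ag At Ob : Type u) : Type u
  | top : Form Ag At Ob
  | atom : At → Form Ag At Ob
  | own : Ag → Ob → Form Ag At Ob
  | neg : Form Ag At Ob → Form Ag At Ob
  | and : Form Ag At Ob → Form Ag At Ob → Form Ag At Ob
  | box : Ag → Form Ag At Ob → Form Ag At Ob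

/-- An enumeration of a finite set, used to write conjunctions and disjunctions indexed by it. -/
noncomputable def enum {α : Type u} (A : Set α) [Finite A] : List α :=
  (Set.toFinite A).toFinset.toList

namespace Form

variable {Ag At Ob : Type u}

def or (φ ψ : Form Ag At Ob) : Form Ag At Ob := neg (and (neg φ) (neg ψ))

def imp (φ ψ : Form Ag At Ob) : Form Ag At Ob := neg (and φ (neg ψ))

/-- Conjunction of a list (`⊤` for the empty list). -/
def conj (l : List (Form Ag At Ob)) : Form Ag At Ob := l.foldr and top

/-- Disjunction of a list (`⊥`, that is `¬⊤`, for the empty list). -/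
def disj (l : List (Form Ag At Ob)) : Form Ag At Ob := l.foldr or (neg top)

/-- Truth of a static formula at a pointed `O`-model. -/
def Sat (M : OModel Ag At Ob) : M.W → Form Ag At Ob → Prop
  | _, top => True
  | w, atom p => w ∈ M.V p
  | w, own i o => o ∈ M.O i w
  | w, neg φ => ¬ Sat M w φ
  | w, and φ ψ => Sat M w φ ∧ Sat M w ψ
  | w, box i φ => ∀ v, M.R i w v → Sat M v φ

end Form

/-- An event `O`-model; `effPos i s` and `effNeg i s` are the positive and negative effects. -/
structure EventModel (Ag At Ob : Type u) where
  S : Type u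
  nonempty : Nonempty S
  finite : Finite S
  T : Ag → S → S → Prop
  pre : S → Form Ag At Ob
  effPos : Ag → S → Set Ob
  effNeg : Ag → S → Set Ob
  effPos_finite : ∀ i s, (effPos i s).Finite
  effNeg_finite : ∀ i s, (effNeg i s).Finite
  eff_disjoint : ∀ i s, Disjoint (effPos i s) (effNeg i s)

instance {Ag At Ob : Type u} (E : EventModel Ag At Ob) : Finite E.S := E.finite

/-- The worlds of the product update: the pairs `(w, s)` with `M, w ⊨ pre s`. -/
abbrev UpdateWorld {Ag At Ob : Type u} (M : OModel Ag At Ob) (E : EventModel Ag At Ob) : Type u :=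
  {p : M.W × E.S // Form.Sat M p.1 (E.pre p.2)}

/-- The product update `M ⊗ E`, available only when some world satisfies some precondition. -/
abbrev OModel.update {Ag At Ob : Type u} (M : OModel Ag At Ob) (E : EventModel Ag At Ob)
    (h : Nonempty (UpdateWorld M E)) : OModel Ag At Ob where
  W := UpdateWorld M E
  nonempty := h
  R i x y := M.R i x.1.1 y.1.1 ∧ E.T i x.1.2 y.1.2
  O i x := (M.O i x.1.1 ∪ E.effPos i x.1.2) \ E.effNeg i x.1.2
  V p := {x | x.1.1 ∈ M.V p}

/-- A possibly partial function from agents to nonempty sets of agents, with nonempty domain. -/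
structure GroupFun (Ag : Type u) where
  dom : Set Ag
  dom_nonempty : dom.Nonempty
  val : dom → Set Ag
  val_nonempty : ∀ i, (val i).Nonempty

/-- The eight group properties. -/
inductive GroupProp
  | presAll
  | presSome
  | antiPresAll
  | antiPresSome
  | invAll
  | invSome
  | antiInvAll
  | antiInvSome

namespace GroupProp

/-- The condition on the objects `X` of agent `i` at `w` and the objects `Y j` of the agents
`j ∈ F = f(i)` at an `i`-successor `u` of `w`. -/
def Cond {Ag Ob : Type u} (F : Set Ag) (X : Set Ob) (Y : Ag → Set Ob) : GroupProp → Prop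
  | presAll => X ⊆ ⋂ j ∈ F, Y j
  | presSome => X ⊆ ⋃ j ∈ F, Y j
  | antiPresAll => (⋃ j ∈ F, Y j) ⊆ X
  | antiPresSome => (⋂ j ∈ F, Y j) ⊆ X
  | invAll => X ∩ (⋃ j ∈ F, Y j) = ∅
  | invSome => X ∩ (⋂ j ∈ F, Y j) = ∅
  | antiInvAll => X ∪ (⋂ j ∈ F, Y j) = Set.univ
  | antiInvSome => X ∪ (⋃ j ∈ F, Y j) = Set.univ

/-- `M` `f`-satisfies the group property `P`. -/
def FSat {Ag At Ob : Type u} (M : OModel Ag At Ob) (f : GroupFun Ag) (P : GroupProp) : Prop :=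
  ∀ i : f.dom, ∀ w v : M.W, M.R i w v → Cond (f.val i) (M.O i w) (fun j => M.O j v) P

/-- The event-model condition on the effects `Xp`, `Xn` of `s` for agent `i` and the effects
`Yp j`, `Yn j` of an `i`-successor `t` of `s` for the agents `j ∈ F = f(i)`. -/
def EMPCond {Ag Ob : Type u} (F : Set Ag) (Xp Xn : Set Ob) (Yp Yn : Ag → Set Ob) :
    GroupProp → Prop
  | presAll => Xp ⊆ (⋂ j ∈ F, Yp j) ∧ (⋃ j ∈ F, Yn j) ⊆ Xn
  | presSome => Xp ⊆ (⋃ j ∈ F, Yp j) ∧ (⋃ j ∈ F, Yn j) ⊆ Xn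
  | antiPresAll => (⋃ j ∈ F, Yp j) ⊆ Xp ∧ Xn ⊆ ⋂ j ∈ F, Yn j
  | antiPresSome => (⋃ j ∈ F, Yp j) ⊆ Xp ∧ Xn ⊆ ⋃ j ∈ F, Yn j
  | invAll => Xp ⊆ (⋂ j ∈ F, Yn j) ∧ (⋃ j ∈ F, Yp j) ⊆ Xn
  | invSome => Xp ⊆ (⋃ j ∈ F, Yn j) ∧ (⋃ j ∈ F, Yp j) ⊆ Xn
  | antiInvAll => Xn ⊆ (⋂ j ∈ F, Yp j) ∧ (⋃ j ∈ F, Yn j) ⊆ Xp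
  | antiInvSome => Xn ⊆ (⋃ j ∈ F, Yp j) ∧ (⋃ j ∈ F, Yn j) ⊆ Xp

/-- The event model `E` `f`-satisfies `EMP(P)`. -/
def EMP {Ag At Ob : Type u} (E : EventModel Ag At Ob) (f : GroupFun Ag) (P : GroupProp) : Prop :=
  ∀ i : f.dom, ∀ s t : E.S, E.T i s t →
    EMPCond (f.val i) (E.effPos i s) (E.effNeg i s) (fun j => E.effPos j t)
      (fun j => E.effNeg j t) P

open Form in
/-- The instance, for the agent `i`, the group `F = f(i)` and the object `o`, of the schema
characterising a group property. -/
noncomputable def schema {Ag At Ob : Type u} [Finite Ag] (i : Ag) (F : Set Ag) (o : Ob) :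
    GroupProp → Form Ag At Ob
  | presAll => imp (own i o) (box i (conj ((enum F).map fun j => own j o)))
  | presSome => imp (own i o) (box i (disj ((enum F).map fun j => own j o)))
  | antiPresAll => imp (neg (own i o)) (box i (conj ((enum F).map fun j => neg (own j o))))
  | antiPresSome => imp (neg (own i o)) (box i (disj ((enum F).map fun j => neg (own j o))))
  | invAll => imp (own i o) (box i (conj ((enum F).map fun j => neg (own j o))))
  | invSome => imp (own i o) (box i (disj ((enum F).map fun j => neg (own j o))))
  | antiInvAll => imp (neg (own i o)) (box i (conj ((enum F).map fun j => own j o)))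
  | antiInvSome => imp (neg (own i o)) (box i (disj ((enum F).map fun j => own j o)))

end GroupProp

/-- The class `𝔐(f₁-P₁, …, fₙ-Pₙ)` of `O`-models. -/
def ModelClass {Ag : Type u} (At Ob : Type u) {n : ℕ} (f : Fin n → GroupFun Ag)
    (P : Fin n → GroupProp) : Set (OModel Ag At Ob) :=
  {M | ∀ k, (P k).FSat M (f k)}

/-- The class `𝔈(f₁-EMP(P₁), …, fₙ-EMP(Pₙ))` of event `O`-models. -/
def EventClass {Ag : Type u} (At Ob : Type u) {n : ℕ} (f : Fin n → GroupFun Ag)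
    (P : Fin n → GroupProp) : Set (EventModel Ag At Ob) :=
  {E | ∀ k, (P k).EMP E (f k)}

/-- The set `⋃ₖ Γ(Pₖ^{fₖ})` of all instances of the characterising schemas. -/
def GroupAxioms {Ag : Type u} [Finite Ag] (At Ob : Type u) {n : ℕ} (f : Fin n → GroupFun Ag)
    (P : Fin n → GroupProp) : Set (Form Ag At Ob) :=
  {φ | ∃ (k : Fin n) (i : (f k).dom) (o : Ob), φ = (P k).schema (i : Ag) ((f k).val i) o}

/-- The dynamic language `L(⋆)` for a class `⋆` of event `O`-models. -/
inductive DForm {Ag At Ob : Type u} (star : Set (EventModel Ag At Ob)) : Type (u + 1)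
  | top : DForm star
  | atom : At → DForm star
  | own : Ag → Ob → DForm star
  | neg : DForm star → DForm star
  | and : DForm star → DForm star → DForm star
  | box : Ag → DForm star → DForm star
  | upd : (E : EventModel Ag At Ob) → E ∈ star → E.S → DForm star → DForm star

namespace DForm

variable {Ag At Ob : Type u} {star : Set (EventModel Ag At Ob)}

def imp (φ ψ : DForm star) : DForm star := neg (and φ (neg ψ))

def iff (φ ψ : DForm star) : DForm star := and (imp φ ψ) (imp ψ φ)

/-- Conjunction of a list (`⊤` for the empty list). -/
def conj (l : List (DForm star)) : DForm star := l.foldr and top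

/-- The inclusion of the static language in `L(⋆)`. -/
def ofForm : Form Ag At Ob → DForm star
  | .top => top
  | .atom p => atom p
  | .own i o => own i o
  | .neg φ => neg (ofForm φ)
  | .and φ ψ => and (ofForm φ) (ofForm ψ)
  | .box i φ => box i (ofForm φ)

/-- Truth of a dynamic formula at a pointed `O`-model. -/
def Sat : DForm star → (M : OModel Ag At Ob) → M.W → Prop
  | top, _, _ => True
  | atom p, M, w => w ∈ M.V p
  | own i o, M, w => o ∈ M.O i w
  | neg φ, M, w => ¬ φ.Sat M w
  | and φ ψ, M, w => φ.Sat M w ∧ ψ.Sat M w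
  | box i φ, M, w => ∀ v, M.R i w v → φ.Sat M v
  | upd E _ s φ, M, w => ∀ h : Form.Sat M w (E.pre s),
      φ.Sat (M.update E ⟨⟨(w, s), h⟩⟩) ⟨(w, s), h⟩

/-- Propositional tautologies of the dynamic language: true under every assignment of truth
values to formulas that respects the Boolean connectives. -/
def Tautology (φ : DForm star) : Prop :=
  ∀ v : DForm star → Prop, v top → (∀ α, v (neg α) ↔ ¬ v α) →
    (∀ α β, v (and α β) ↔ v α ∧ v β) → v φ

/-- `Replace φ ψ δ δ'`: `δ'` results from `δ` by substituting `ψ` for some occurrences of `φ`,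
where the event models in dynamic modalities are left untouched. (Substituting no occurrence is
permitted; it only yields the tautologies `δ ↔ δ` in the substitution rule.) -/
inductive Replace (φ ψ : DForm star) : DForm star → DForm star → Prop
  | here : Replace φ ψ φ ψ
  | refl (δ : DForm star) : Replace φ ψ δ δ
  | neg {δ δ' : DForm star} : Replace φ ψ δ δ' → Replace φ ψ (neg δ) (neg δ')
  | and {δ δ' ε ε' : DForm star} : Replace φ ψ δ δ' → Replace φ ψ ε ε' →
      Replace φ ψ (and δ ε) (and δ' ε')
  | box (i : Ag) {δ δ' : DForm star} : Replace φ ψ δ δ' → Replace φ ψ (box i δ) (box i δ')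
  | upd (E : EventModel Ag At Ob) (hE : E ∈ star) (s : E.S) {δ δ' : DForm star} :
      Replace φ ψ δ δ' → Replace φ ψ (upd E hE s δ) (upd E hE s δ')

/-- The theorems of the dynamic logic over `star` whose additional static axioms are `Γ`:
the minimal modal logic, the axioms `Γ`, the reduction axioms and the substitution rule. -/
inductive Provable (Γ : Set (Form Ag At Ob)) : DForm star → Prop
  | taut {φ : DForm star} : Tautology φ → Provable Γ φ
  | axK (i : Ag) (φ ψ : DForm star) :
      Provable Γ (imp (box i (imp φ ψ)) (imp (box i φ) (box i ψ)))
  | group {φ : Form Ag At Ob} : φ ∈ Γ → Provable Γ (ofForm φ)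
  | mp {φ ψ : DForm star} : Provable Γ φ → Provable Γ (imp φ ψ) → Provable Γ ψ
  | nec (i : Ag) {φ : DForm star} : Provable Γ φ → Provable Γ (box i φ)
  | redTop (E : EventModel Ag At Ob) (hE : E ∈ star) (s : E.S) :
      Provable Γ (iff (upd E hE s top) top)
  | redAtom (E : EventModel Ag At Ob) (hE : E ∈ star) (s : E.S) (p : At) :
      Provable Γ (iff (upd E hE s (atom p)) (imp (ofForm (E.pre s)) (atom p)))
  | redOwn (E : EventModel Ag At Ob) (hE : E ∈ star) (s : E.S) (i : Ag) (x : Ob) :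
      x ∉ E.effPos i s ∪ E.effNeg i s →
      Provable Γ (iff (upd E hE s (own i x)) (imp (ofForm (E.pre s)) (own i x)))
  | redOwnPos (E : EventModel Ag At Ob) (hE : E ∈ star) (s : E.S) (i : Ag) (x : Ob) :
      x ∈ E.effPos i s → Provable Γ (iff (upd E hE s (own i x)) top)
  | redOwnNeg (E : EventModel Ag At Ob) (hE : E ∈ star) (s : E.S) (i : Ag) (x : Ob) :
      x ∈ E.effNeg i s →
      Provable Γ (iff (upd E hE s (own i x)) (neg (ofForm (E.pre s))))
  | redNeg (E : EventModel Ag At Ob) (hE : E ∈ star) (s : E.S) (φ : DForm star) :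
      Provable Γ (iff (upd E hE s (neg φ)) (imp (ofForm (E.pre s)) (neg (upd E hE s φ))))
  | redAnd (E : EventModel Ag At Ob) (hE : E ∈ star) (s : E.S) (φ ψ : DForm star) :
      Provable Γ (iff (upd E hE s (and φ ψ)) (and (upd E hE s φ) (upd E hE s ψ)))
  | redBox (E : EventModel Ag At Ob) (hE : E ∈ star) (s : E.S) (i : Ag) (φ : DForm star) :
      Provable Γ (iff (upd E hE s (box i φ))
        (imp (ofForm (E.pre s))
          (conj ((enum {t | E.T i s t}).map fun t => box i (upd E hE t φ)))))
  | subst {φ ψ δ δ' : DForm star} : Replace φ ψ δ δ' → Provable Γ (iff φ ψ) →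
      Provable Γ (iff δ δ')

/-- Deducibility from assumptions: some finite conjunction of members of `Φ` provably
implies `φ`. -/
def Deducible (Γ : Set (Form Ag At Ob)) (Φ : Set (DForm star)) (φ : DForm star) : Prop :=
  ∃ l : List (DForm star), (∀ ψ ∈ l, ψ ∈ Φ) ∧ Provable Γ (imp (conj l) φ)

/-- Local semantic consequence over a class of `O`-models. -/
def Consequence (C : Set (OModel Ag At Ob)) (Φ : Set (DForm star)) (φ : DForm star) : Prop :=
  ∀ M ∈ C, ∀ w : M.W, (∀ ψ ∈ Φ, ψ.Sat M w) → φ.Sat M w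

/-- Validity on a class of `O`-models. -/
def ValidOn (C : Set (OModel Ag At Ob)) (φ : DForm star) : Prop :=
  ∀ M ∈ C, ∀ w : M.W, φ.Sat M w

end DForm

/-- The dynamic language `L(𝔈(f₁-EMP(P₁), …, fₙ-EMP(Pₙ)))`. -/
abbrev DynForm {Ag : Type u} (At Ob : Type u) {n : ℕ} (f : Fin n → GroupFun Ag)
    (P : Fin n → GroupProp) : Type (u + 1) :=
  DForm (EventClass At Ob f P)

/-- Theoremhood in the dynamic logic `L^!(f₁-P₁, …, fₙ-Pₙ)`. -/
def DynProvable {Ag At Ob : Type u} [Finite Ag] {n : ℕ} (f : Fin n → GroupFun Ag)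
    (P : Fin n → GroupProp) (φ : DynForm At Ob f P) : Prop :=
  DForm.Provable (GroupAxioms At Ob f P) φ

/-- Deducibility from assumptions in the dynamic logic `L^!(f₁-P₁, …, fₙ-Pₙ)`. -/
def DynDeducible {Ag At Ob : Type u} [Finite Ag] {n : ℕ} (f : Fin n → GroupFun Ag)
    (P : Fin n → GroupProp) (Φ : Set (DynForm At Ob f P)) (φ : DynForm At Ob f P) : Prop :=
  DForm.Deducible (GroupAxioms At Ob f P) Φ φ

end OLogic

/-! Soundness rests on closure under updates: the effect conditions `EMPCond` keep the group
properties true in the product (`GroupProp.Cond.update`), so validity over the class survives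
substitution below a dynamic modality. Completeness is by reduction to the static language. The
reduction axioms push an update through the connectives until it disappears, so every formula is
provably equivalent to a static one (`exists_static`). A canonical model then only needs a truth
lemma for static formulas (`sat_canonicalModel_iff`). It lies in the class because the group axioms
belong to all its worlds and, being characteristic (`mem_ModelClass_iff`), force the group
properties. Soundness on this very model carries truth back from static formulas to dynamic ones. -/

namespace OLogic

/-! ### Semantics of the connectives -/

namespace Form

variable {Ag At Ob : Type u} {M : OModel Ag At Ob} {w : M.W}

theorem sat_imp {φ ψ : Form Ag At Ob} : Sat M w (imp φ ψ) ↔ (Sat M w φ → Sat M w ψ) := by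
  simp [imp, Sat]

theorem sat_or {φ ψ : Form Ag At Ob} : Sat M w (or φ ψ) ↔ (Sat M w φ ∨ Sat M w ψ) := by
  simp only [or, Sat]; tauto

theorem sat_conj {l : List (Form Ag At Ob)} : Sat M w (conj l) ↔ ∀ φ ∈ l, Sat M w φ := by
  induction l with
  | nil => simp [conj, Sat]
  | cons a l ih => simpa [conj, Sat] using fun _ => ih

theorem sat_disj {l : List (Form Ag At Ob)} : Sat M w (disj l) ↔ ∃ φ ∈ l, Sat M w φ := by
  induction l with
  | nil => simp [disj, Sat]
  | cons a l ih =>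
    have h : disj (a :: l) = or a (disj l) := rfl
    simp [h, sat_or, ih]

end Form

theorem mem_enum {α : Type u} (A : Set α) [Finite A] {a : α} : a ∈ enum A ↔ a ∈ A := by
  simp [enum]

namespace DForm

variable {Ag At Ob : Type u} {star : Set (EventModel Ag At Ob)} {M : OModel Ag At Ob} {w : M.W}

theorem sat_imp {φ ψ : DForm star} : (imp φ ψ).Sat M w ↔ (φ.Sat M w → ψ.Sat M w) := by
  simp [imp, Sat]

theorem sat_iff {φ ψ : DForm star} : (iff φ ψ).Sat M w ↔ (φ.Sat M w ↔ ψ.Sat M w) := by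
  simp only [iff, Sat, sat_imp]; tauto

theorem sat_conj {l : List (DForm star)} : (conj l).Sat M w ↔ ∀ φ ∈ l, φ.Sat M w := by
  induction l with
  | nil => simp [conj, Sat]
  | cons a l ih => simpa [conj, Sat] using fun _ => ih

theorem sat_ofForm {φ : Form Ag At Ob} :
    (ofForm φ : DForm star).Sat M w ↔ Form.Sat M w φ := by
  induction φ generalizing w <;> simp_all [ofForm, Sat, Form.Sat]

end DForm

/-! ### Group properties -/

namespace GroupProp

variable {Ag At Ob : Type u}

/-- The conditions on effects guarantee that updated object sets keep the group property. -/
theorem Cond.update {F : Set Ag} {P : GroupProp} {X Xp Xn : Set Ob} {Y Yp Yn : Ag → Set Ob}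
    (hY : ∀ j, Disjoint (Yp j) (Yn j)) (h : Cond F X Y P) (hE : EMPCond F Xp Xn Yp Yn P) :
    Cond F ((X ∪ Xp) \ Xn) (fun j => (Y j ∪ Yp j) \ Yn j) P := by
  have hd : ∀ j x, x ∈ Yp j → x ∉ Yn j := fun j x hp hn =>
    Set.disjoint_left.mp (hY j) hp hn
  -- Each property is a claim about one object `x` at a time, so after fixing `x` only membership
  -- logic remains. Disjointness matters for anti-inversion: an object of `Xn` enters through some
  -- `Yp j` and must not be removed by `Yn j`.
  cases P <;>
    simp only [Cond, EMPCond, Set.subset_def, Set.mem_iInter, Set.mem_iUnion, Set.mem_sdiff,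
      Set.mem_union, Set.eq_empty_iff_forall_notMem, Set.mem_inter_iff,
      Set.eq_univ_iff_forall, exists_prop] at h hE ⊢ <;>
    intro x <;> have hx := h x <;> have h1 := hE.1 x <;> have h2 := hE.2 x <;>
    have hdx := fun j => hd j x <;> clear h hE hd hY <;> grind

theorem FSat.update {M : OModel Ag At Ob} {E : EventModel Ag At Ob} {f : GroupFun Ag}
    {P : GroupProp} (hM : P.FSat M f) (hE : P.EMP E f) (h : Nonempty (UpdateWorld M E)) :
    P.FSat (M.update E h) f := fun i x y hxy =>
  Cond.update (fun j => E.eff_disjoint j y.1.2) (hM i x.1.1 y.1.1 hxy.1)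
    (hE i x.1.2 y.1.2 hxy.2)

/-- The schema for one agent and group holds at a world for every object exactly when the group
property's condition holds along all the agent's arrows from that world. -/
theorem forall_sat_schema_iff [Finite Ag] {M : OModel Ag At Ob} {w : M.W} {i : Ag} {F : Set Ag}
    {P : GroupProp} :
    (∀ o, Form.Sat M w (P.schema i F o)) ↔
      ∀ v, M.R i w v → Cond F (M.O i w) (fun j => M.O j v) P := by
  cases P <;>
    simp only [schema, Cond, Form.sat_imp, Form.Sat, Form.sat_conj, Form.sat_disj,
      forall_exists_index, and_imp, forall_apply_eq_imp_iff₂, List.mem_map, mem_enum,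
      exists_exists_and_eq_and, Set.subset_def,
      Set.mem_iInter, Set.mem_iUnion, Set.eq_empty_iff_forall_notMem, Set.mem_inter_iff,
      Set.mem_union, Set.eq_univ_iff_forall, exists_prop] <;>
    grind

end GroupProp

section Classes

variable {Ag At Ob : Type u} {n : ℕ} {f : Fin n → GroupFun Ag} {P : Fin n → GroupProp}

theorem ModelClass.update {M : OModel Ag At Ob} (hM : M ∈ ModelClass At Ob f P)
    {E : EventModel Ag At Ob} (hE : E ∈ EventClass At Ob f P)
    (h : Nonempty (UpdateWorld M E)) : M.update E h ∈ ModelClass At Ob f P :=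
  fun k => (hM k).update (hE k) h

/-- The group axioms characterise the class of models. -/
theorem mem_ModelClass_iff [Finite Ag] {M : OModel Ag At Ob} :
    M ∈ ModelClass At Ob f P ↔ ∀ φ ∈ GroupAxioms At Ob f P, ∀ w, Form.Sat M w φ := by
  constructor
  · rintro hM _ ⟨k, i, o, rfl⟩ w
    exact GroupProp.forall_sat_schema_iff.mpr (hM k i w) o
  · intro h k i w
    exact GroupProp.forall_sat_schema_iff.mp fun o => h _ ⟨k, i, o, rfl⟩ w

end Classes

namespace DForm

variable {Ag At Ob : Type u} {star : Set (EventModel Ag At Ob)} {Γ : Set (Form Ag At Ob)}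

/-! ### Soundness -/

section Soundness

variable {C : Set (OModel Ag At Ob)}

/-- Truth of `upd` is evaluated in another model, so agreement in one model is not enough for the
induction: it runs over a whole class closed under updates. -/
theorem Replace.validOn
    (hup : ∀ M ∈ C, ∀ E ∈ star, ∀ h : Nonempty (UpdateWorld M E), M.update E h ∈ C)
    {φ ψ δ δ' : DForm star} (hr : Replace φ ψ δ δ') (h : ValidOn C (iff φ ψ)) :
    ValidOn C (iff δ δ') := by
  induction hr with
  | here => exact h
  | refl δ => exact fun M _ w => sat_iff.mpr Iff.rfl
  | neg _ ih => exact fun M hM w => sat_iff.mpr (not_congr (sat_iff.mp (ih M hM w)))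
  | and _ _ ih₁ ih₂ =>
    exact fun M hM w => sat_iff.mpr
      (and_congr (sat_iff.mp (ih₁ M hM w)) (sat_iff.mp (ih₂ M hM w)))
  | box i _ ih =>
    exact fun M hM w => sat_iff.mpr
      (forall_congr' fun v => imp_congr_right fun _ => sat_iff.mp (ih M hM v))
  | upd E hE s _ ih =>
    exact fun M hM w => sat_iff.mpr
      (forall_congr' fun hw => sat_iff.mp (ih _ (hup M hM E hE _) _))

/-- Closure under updates serves only the substitution rule; the reduction axioms hold in every
model. -/
theorem Provable.validOn
    (hup : ∀ M ∈ C, ∀ E ∈ star, ∀ h : Nonempty (UpdateWorld M E), M.update E h ∈ C)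
    (hΓ : ∀ φ ∈ Γ, ∀ M ∈ C, ∀ w, Form.Sat M w φ)
    {φ : DForm star} (h : Provable Γ φ) : ValidOn C φ := by
  induction h with
  | taut h =>
    exact fun M _ w => h (fun α => α.Sat M w) trivial (fun _ => Iff.rfl) fun _ _ => Iff.rfl
  | axK i φ ψ =>
    intro M _ w
    simp only [sat_imp, Sat]
    exact fun h₁ h₂ v hv => h₁ v hv (h₂ v hv)
  | group h => exact fun M hM w => sat_ofForm.mpr (hΓ _ h M hM w)
  | mp _ _ ih₁ ih₂ => exact fun M hM w => sat_imp.mp (ih₂ M hM w) (ih₁ M hM w)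
  | nec i _ ih => exact fun M hM w v _ => ih M hM v
  | redTop E hE s => exact fun M _ w => by simp [sat_iff, Sat]
  | redAtom E hE s p => exact fun M _ w => by simp [sat_iff, sat_imp, sat_ofForm, Sat]
  | redOwn E hE s i x hx =>
    intro M _ w
    simp only [Set.mem_union, not_or] at hx
    simp [sat_iff, sat_imp, sat_ofForm, Sat, hx]
  | redOwnPos E hE s i x hx =>
    intro M _ w
    -- The update removes negative effects last, so a gained object stays only because the effects
    -- are disjoint.
    have := Set.disjoint_left.mp (E.eff_disjoint i s) hx
    simp [sat_iff, Sat, hx, this]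
  | redOwnNeg E hE s i x hx => exact fun M _ w => by simp [sat_iff, sat_ofForm, Sat, hx]
  | redNeg E hE s φ =>
    intro M _ w
    simp only [sat_iff, sat_imp, sat_ofForm, Sat]
    exact ⟨fun h hw h' => h hw (h' hw), fun h hw h' => h hw fun _ => h'⟩
  | redAnd E hE s φ ψ => exact fun M _ w => by simp [sat_iff, Sat, forall_and]
  | redBox E hE s i φ =>
    intro M _ w
    simp only [sat_iff, sat_imp, sat_ofForm, Sat, sat_conj, List.forall_mem_map, mem_enum,
      Set.mem_ofPred_eq]
    exact ⟨fun h hw t ht v hv hv' => h hw ⟨(v, t), hv'⟩ ⟨hv, ht⟩,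
      fun h hw v hv => h hw v.1.2 hv.2 v.1.1 hv.1 v.2⟩
  | subst hr _ ih => exact hr.validOn hup ih

end Soundness

/-! ### Propositional reasoning -/

section Boolean

variable {v : DForm star → Prop}

theorem val_imp (hn : ∀ α, v (neg α) ↔ ¬ v α) (ha : ∀ α β, v (and α β) ↔ v α ∧ v β)
    {φ ψ : DForm star} : v (imp φ ψ) ↔ (v φ → v ψ) := by
  simp [imp, hn, ha]

theorem val_iff (hn : ∀ α, v (neg α) ↔ ¬ v α) (ha : ∀ α β, v (and α β) ↔ v α ∧ v β)
    {φ ψ : DForm star} : v (iff φ ψ) ↔ (v φ ↔ v ψ) := by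
  simp only [iff, ha, val_imp hn ha]; tauto

theorem val_conj (ht : v top) (ha : ∀ α β, v (and α β) ↔ v α ∧ v β)
    {l : List (DForm star)} : v (conj l) ↔ ∀ φ ∈ l, v φ := by
  induction l with
  | nil => simpa [conj] using ht
  | cons a l ih =>
    have h : conj (a :: l) = and a (conj l) := rfl
    simp [h, ha, ih]

end Boolean

namespace Provable

variable {φ ψ χ : DForm star}

theorem imp_of_iff (h : Provable Γ (iff φ ψ)) : Provable Γ (imp φ ψ) :=
  h.mp <| .taut fun v _ hn ha => by simp only [val_imp hn ha, val_iff hn ha]; tauto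

theorem iff_refl : Provable Γ (iff φ φ) :=
  .taut fun v _ hn ha => by simp only [val_iff hn ha]

theorem iff_trans (h₁ : Provable Γ (iff φ ψ)) (h₂ : Provable Γ (iff ψ χ)) :
    Provable Γ (iff φ χ) :=
  h₂.mp <| h₁.mp <| .taut fun v _ hn ha => by
    simp only [val_imp hn ha, val_iff hn ha]; tauto

theorem iff_neg (h : Provable Γ (iff φ ψ)) : Provable Γ (iff (neg φ) (neg ψ)) :=
  .subst (.neg .here) h

theorem iff_and {φ' ψ' : DForm star} (h₁ : Provable Γ (iff φ ψ)) (h₂ : Provable Γ (iff φ' ψ')) :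
    Provable Γ (iff (and φ φ') (and ψ ψ')) :=
  h₂.mp <| h₁.mp <| .taut fun v _ hn ha => by
    simp only [val_imp hn ha, val_iff hn ha, ha]; tauto

theorem iff_imp {φ' ψ' : DForm star} (h₁ : Provable Γ (iff φ ψ)) (h₂ : Provable Γ (iff φ' ψ')) :
    Provable Γ (iff (imp φ φ') (imp ψ ψ')) :=
  (h₁.iff_and h₂.iff_neg).iff_neg

theorem iff_box (i : Ag) (h : Provable Γ (iff φ ψ)) : Provable Γ (iff (box i φ) (box i ψ)) :=
  .subst (.box i .here) h

/-- This is where the substitution rule is indispensable: the calculus has neither necessitation nor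
a K axiom for dynamic modalities. -/
theorem iff_upd {E : EventModel Ag At Ob} (hE : E ∈ star) (s : E.S) (h : Provable Γ (iff φ ψ)) :
    Provable Γ (iff (upd E hE s φ) (upd E hE s ψ)) :=
  .subst (.upd E hE s .here) h

theorem iff_conj_map {α : Type*} {g g' : α → DForm star} (l : List α)
    (h : ∀ a ∈ l, Provable Γ (iff (g a) (g' a))) :
    Provable Γ (iff (conj (l.map g)) (conj (l.map g'))) := by
  induction l with
  | nil => exact iff_refl
  | cons a l ih =>
    exact iff_and (h a (by simp)) (ih fun b hb => h b (by simp [hb]))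

/-- Boxes distribute over a provable implication from a finite conjunction. -/
theorem box_conj (i : Ag) {l : List (DForm star)} (h : Provable Γ (imp (conj l) φ)) :
    Provable Γ (imp (conj (l.map (box i))) (box i φ)) := by
  induction l generalizing φ with
  | nil =>
    have h' : Provable Γ φ := mp (.taut fun _ ht _ _ => ht) h
    exact (h'.nec i).mp <| .taut fun v _ hn ha => by simp only [val_imp hn ha]; tauto
  | cons a l ih =>
    -- Currying moves the head into the conclusion, where the induction hypothesis boxes `imp a φ`
    -- and K splits the box.
    have h' : Provable Γ (imp (conj l) (imp a φ)) := h.mp <| .taut fun v ht hn ha => by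
      simp only [val_imp hn ha, val_conj ht ha, List.forall_mem_cons]; tauto
    exact (axK i a φ).mp <| (ih h').mp <| .taut fun v ht hn ha => by
      simp only [val_imp hn ha, val_conj ht ha, List.map_cons, List.forall_mem_cons]; tauto

end Provable

/-! ### Reduction to the static language -/

section Reduction

theorem ofForm_imp (φ ψ : Form Ag At Ob) :
    (ofForm (.imp φ ψ) : DForm star) = imp (ofForm φ) (ofForm ψ) := rfl

theorem ofForm_conj (l : List (Form Ag At Ob)) :
    (ofForm (.conj l) : DForm star) = conj (l.map ofForm) := by
  induction l with
  | nil => rfl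
  | cons a l ih => exact congrArg (and (ofForm a)) ih

/-- Eliminates a single update in front of a formula that is already static, so no axiom for nested
updates and no complexity measure is needed. The event `s` is quantified inside the induction
because the box case passes to its successors. -/
theorem exists_static_upd {E : EventModel Ag At Ob} (hE : E ∈ star) (φ : Form Ag At Ob) :
    ∀ s : E.S, ∃ χ : Form Ag At Ob,
      Provable Γ (iff (upd E hE s (ofForm φ) : DForm star) (ofForm χ)) := by
  induction φ with
  | top => exact fun s => ⟨.top, .redTop E hE s⟩
  | atom p => exact fun s => ⟨.imp (E.pre s) (.atom p), .redAtom E hE s p⟩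
  | own i x =>
    intro s
    by_cases hp : x ∈ E.effPos i s
    · exact ⟨.top, .redOwnPos E hE s i x hp⟩
    by_cases hn : x ∈ E.effNeg i s
    · exact ⟨.neg (E.pre s), .redOwnNeg E hE s i x hn⟩
    · exact ⟨.imp (E.pre s) (.own i x), .redOwn E hE s i x (by simp [hp, hn])⟩
  | neg φ ih =>
    intro s
    obtain ⟨χ, hχ⟩ := ih s
    exact ⟨.imp (E.pre s) (.neg χ),
      (Provable.redNeg E hE s _).iff_trans (.iff_imp .iff_refl hχ.iff_neg)⟩
  | and φ ψ ih₁ ih₂ =>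
    intro s
    obtain ⟨χ₁, h₁⟩ := ih₁ s
    obtain ⟨χ₂, h₂⟩ := ih₂ s
    exact ⟨.and χ₁ χ₂, (Provable.redAnd E hE s _ _).iff_trans (h₁.iff_and h₂)⟩
  | box i φ ih =>
    intro s
    choose χ hχ using ih
    refine ⟨.imp (E.pre s) (.conj ((enum {t | E.T i s t}).map fun t => .box i (χ t))),
      (Provable.redBox E hE s i _).iff_trans ?_⟩
    rw [ofForm_imp, ofForm_conj, List.map_map]
    exact .iff_imp .iff_refl (.iff_conj_map _ fun t _ => (hχ t).iff_box i)

/-- Every dynamic formula is provably equivalent to a static one. -/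
theorem exists_static (φ : DForm star) :
    ∃ χ : Form Ag At Ob, Provable Γ (iff φ (ofForm χ)) := by
  induction φ with
  | top => exact ⟨.top, .iff_refl⟩
  | atom p => exact ⟨.atom p, .iff_refl⟩
  | own i o => exact ⟨.own i o, .iff_refl⟩
  | neg φ ih => exact ih.imp' Form.neg fun _ h => h.iff_neg
  | and φ ψ ih₁ ih₂ =>
    obtain ⟨χ₁, h₁⟩ := ih₁
    obtain ⟨χ₂, h₂⟩ := ih₂
    exact ⟨.and χ₁ χ₂, h₁.iff_and h₂⟩
  | box i φ ih => exact ih.imp' (Form.box i) fun _ h => h.iff_box i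
  | upd E hE s φ ih =>
    -- Innermost updates go first: the body is made static, and then the outer update is removed.
    obtain ⟨χ, h⟩ := ih
    obtain ⟨χ', h'⟩ := exists_static_upd (Γ := Γ) hE χ s
    exact ⟨χ', (h.iff_upd hE s).iff_trans h'⟩

end Reduction

/-! ### Deducibility and maximal consistent sets -/

namespace Deducible

variable {Φ Ψ : Set (DForm star)} {φ ψ : DForm star}

theorem of_provable (h : Provable Γ φ) : Deducible Γ Φ φ :=
  ⟨[], by simp, h.mp <| .taut fun v _ hn ha => by simp only [val_imp hn ha]; tauto⟩

theorem of_mem (h : φ ∈ Φ) : Deducible Γ Φ φ :=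
  ⟨[φ], by simpa using h, .taut fun v ht hn ha => by
    simp [val_imp hn ha, val_conj ht ha]⟩

theorem mp (h₁ : Deducible Γ Φ φ) (h₂ : Deducible Γ Φ (imp φ ψ)) : Deducible Γ Φ ψ := by
  obtain ⟨l₁, hl₁, h₁⟩ := h₁
  obtain ⟨l₂, hl₂, h₂⟩ := h₂
  refine ⟨l₁ ++ l₂, fun χ hχ => (List.mem_append.mp hχ).elim (hl₁ χ) (hl₂ χ),
    h₂.mp <| h₁.mp <| .taut fun v ht hn ha => ?_⟩
  simp only [val_imp hn ha, val_conj ht ha, List.mem_append]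
  exact fun h₁ h₂ h => h₂ (fun χ hχ => h χ (.inr hχ)) (h₁ fun χ hχ => h χ (.inl hχ))

theorem deduction (h : Deducible Γ (insert φ Φ) ψ) : Deducible Γ Φ (imp φ ψ) := by
  classical
  obtain ⟨l, hl, h⟩ := h
  -- All copies of `φ` leave the premises; the new antecedent supplies them.
  refine ⟨l.filter (· ≠ φ), fun χ hχ => ?_, h.mp <| .taut fun v ht hn ha => ?_⟩
  · simp only [List.mem_filter, decide_eq_true_eq] at hχ
    exact (hl χ hχ.1).resolve_left hχ.2
  · simp only [val_imp hn ha, val_conj ht ha, List.mem_filter, decide_eq_true_eq]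
    intro h₁ h₂ hφ
    refine h₁ fun χ hχ => ?_
    by_cases he : χ = φ
    · exact he ▸ hφ
    · exact h₂ χ ⟨hχ, he⟩

end Deducible

/-- No contradiction can be deduced from `Φ`. -/
def Consistent (Γ : Set (Form Ag At Ob)) (Φ : Set (DForm star)) : Prop :=
  ¬ Deducible Γ Φ (neg top)

/-- Consistent sets without proper consistent extensions. -/
abbrev MaxConsistent (Γ : Set (Form Ag At Ob)) (Φ : Set (DForm star)) : Prop :=
  Maximal (Consistent Γ) Φ

theorem consistent_insert_neg {Φ : Set (DForm star)} {φ : DForm star}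
    (h : ¬ Deducible Γ Φ φ) : Consistent Γ (insert (neg φ) Φ) := fun hc =>
  h <| hc.deduction.mp <| .of_provable <| .taut fun v ht hn ha => by
    simp only [val_imp hn ha, hn]; tauto

/-- Zorn's lemma, since the language need not be countable: it contains modalities for arbitrary
event models in `star`. A deduction uses finitely many premises, so one from the union of a chain
already takes place in a member. -/
theorem Consistent.exists_maxConsistent {Φ : Set (DForm star)} (h : Consistent Γ Φ) :
    ∃ Δ, Φ ⊆ Δ ∧ MaxConsistent Γ Δ := by
  refine zorn_subset_nonempty {Ψ | Consistent Γ Ψ} (fun c hc hchain hne => ?_) Φ h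
  refine ⟨⋃₀ c, ?_, fun s hs => Set.subset_sUnion_of_mem hs⟩
  rintro ⟨l, hl, hp⟩
  obtain ⟨s, hs, hls⟩ := hchain.directedOn.exists_mem_subset_of_finite_of_subset_sUnion hne
    (List.finite_toSet l) hl
  exact hc hs ⟨l, hls, hp⟩

namespace MaxConsistent

variable {Δ : Set (DForm star)} {φ ψ : DForm star}

theorem mem_of_deducible (hΔ : MaxConsistent Γ Δ) (h : Deducible Γ Δ φ) : φ ∈ Δ :=
  hΔ.mem_of_prop_insert fun hc => hΔ.prop (h.mp hc.deduction)

theorem mem_of_provable (hΔ : MaxConsistent Γ Δ) (h : Provable Γ φ) : φ ∈ Δ :=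
  hΔ.mem_of_deducible (.of_provable h)

theorem mem_of_imp (hΔ : MaxConsistent Γ Δ) (h : Provable Γ (imp φ ψ)) (hφ : φ ∈ Δ) : ψ ∈ Δ :=
  hΔ.mem_of_deducible ((Deducible.of_mem hφ).mp (.of_provable h))

theorem neg_mem_iff (hΔ : MaxConsistent Γ Δ) : neg φ ∈ Δ ↔ φ ∉ Δ := by
  refine ⟨fun hn hφ => hΔ.prop ?_, fun h => ?_⟩
  · exact (Deducible.of_mem hφ).mp <| (Deducible.of_mem hn).mp <| .of_provable <|
      .taut fun v ht hn ha => by simp only [val_imp hn ha, hn]; tauto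
  · exact hΔ.mem_of_prop_insert <| consistent_insert_neg fun hd => h (hΔ.mem_of_deducible hd)

theorem and_mem_iff (hΔ : MaxConsistent Γ Δ) : and φ ψ ∈ Δ ↔ φ ∈ Δ ∧ ψ ∈ Δ := by
  refine ⟨fun h => ⟨hΔ.mem_of_imp ?_ h, hΔ.mem_of_imp ?_ h⟩, fun h => ?_⟩
  · exact .taut fun v ht hn ha => by simp only [val_imp hn ha, ha]; tauto
  · exact .taut fun v ht hn ha => by simp only [val_imp hn ha, ha]; tauto
  · exact hΔ.mem_of_deducible <| (Deducible.of_mem h.2).mp <| (Deducible.of_mem h.1).mp <|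
      .of_provable <| .taut fun v ht hn ha => by simp only [val_imp hn ha, ha]; tauto

/-- A box missing from a maximal consistent set is refuted in a maximal consistent set that
contains every static formula boxed in the first one. -/
theorem exists_of_box_notMem (hΔ : MaxConsistent Γ Δ) {i : Ag} {χ : Form Ag At Ob}
    (h : (ofForm (.box i χ) : DForm star) ∉ Δ) :
    ∃ Δ' : Set (DForm star), MaxConsistent Γ Δ' ∧ ofForm χ ∉ Δ' ∧
      ∀ ψ : Form Ag At Ob, ofForm (.box i ψ) ∈ Δ → ofForm ψ ∈ Δ' := by
  -- A deduction from the unboxed formulas could be boxed throughout by `box_conj`, which would put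
  -- the missing box into `Δ`.
  have hnd : ¬ Deducible Γ {ψ : DForm star | box i ψ ∈ Δ} (ofForm χ) := by
    rintro ⟨l, hl, hp⟩
    refine h (hΔ.mem_of_deducible ⟨l.map (box i), ?_, hp.box_conj i⟩)
    simpa using hl
  obtain ⟨Δ', hsub, hΔ'⟩ := (consistent_insert_neg hnd).exists_maxConsistent
  exact ⟨Δ', hΔ', hΔ'.neg_mem_iff.mp (hsub (Set.mem_insert _ _)),
    fun ψ hψ => hsub (Set.mem_insert_of_mem _ hψ)⟩

end MaxConsistent

/-! ### The canonical model -/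

/-- The canonical model, built from the static parts of the maximal consistent sets. -/
def canonicalModel (Γ : Set (Form Ag At Ob)) (star : Set (EventModel Ag At Ob))
    (h : ∃ Δ : Set (DForm star), MaxConsistent Γ Δ) : OModel Ag At Ob where
  -- Sets of dynamic formulas live in `Type (u + 1)`, too high for the worlds of an `OModel`; their
  -- static traces live in `Type u`.
  W := {T : Set (Form Ag At Ob) // ∃ Δ : Set (DForm star), MaxConsistent Γ Δ ∧ ofForm ⁻¹' Δ = T}
  nonempty := h.elim fun Δ hΔ => ⟨_, Δ, hΔ, rfl⟩
  R i S T := ∀ φ, .box i φ ∈ S.1 → φ ∈ T.1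
  O i T := {o | .own i o ∈ T.1}
  V p := {T | .atom p ∈ T.1}

/-- The truth lemma. Each case picks a maximal consistent set with trace `T`; any choice works, as
only static formulas are tested. -/
theorem sat_canonicalModel_iff (h : ∃ Δ : Set (DForm star), MaxConsistent Γ Δ)
    (φ : Form Ag At Ob) (T : (canonicalModel Γ star h).W) :
    Form.Sat (canonicalModel Γ star h) T φ ↔ φ ∈ T.1 := by
  induction φ generalizing T with
  | top =>
    obtain ⟨_, Δ, hΔ, rfl⟩ := T
    exact ⟨fun _ => hΔ.mem_of_provable (.taut fun _ ht _ _ => ht), fun _ => trivial⟩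
  | atom p => exact Iff.rfl
  | own i o => exact Iff.rfl
  | neg φ ih =>
    refine (not_congr (ih T)).trans ?_
    obtain ⟨_, Δ, hΔ, rfl⟩ := T
    exact hΔ.neg_mem_iff.symm
  | and φ ψ ih₁ ih₂ =>
    refine (and_congr (ih₁ T) (ih₂ T)).trans ?_
    obtain ⟨_, Δ, hΔ, rfl⟩ := T
    exact hΔ.and_mem_iff.symm
  | box i φ ih =>
    refine ⟨fun hs => ?_, fun hm S hS => (ih S).mpr (hS φ hm)⟩
    by_contra hm
    obtain ⟨_, Δ, hΔ, rfl⟩ := T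
    obtain ⟨Δ', hΔ', hφ, hR⟩ := hΔ.exists_of_box_notMem hm
    exact hφ ((ih ⟨_, Δ', hΔ', rfl⟩).mp (hs _ hR))

end DForm

end OLogic

/-! ### Soundness and strong completeness -/

open OLogic DForm in
theorem mainTheorem2 {Ag At Ob : Type u} [Finite Ag] [Nonempty Ag] [Countable At]
    [Countable Ob] [Nonempty Ob] {n : ℕ} (f : Fin n → OLogic.GroupFun Ag)
    (P : Fin n → OLogic.GroupProp) :
    (∀ φ : OLogic.DynForm At Ob f P, OLogic.DynProvable f P φ →
      OLogic.DForm.ValidOn (OLogic.ModelClass At Ob f P) φ) ∧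
    (∀ (Φ : Set (OLogic.DynForm At Ob f P)) (φ : OLogic.DynForm At Ob f P),
      OLogic.DynDeducible f P Φ φ ↔
        OLogic.DForm.Consequence (OLogic.ModelClass At Ob f P) Φ φ) := by
  have sound : ∀ φ : DynForm At Ob f P, DynProvable f P φ →
      ValidOn (ModelClass At Ob f P) φ := fun φ h =>
    h.validOn (fun _ hM _ hE => ModelClass.update hM hE) fun φ hφ M hM => mem_ModelClass_iff.mp hM φ hφ
  refine ⟨sound, fun Φ φ => ⟨?_, fun hc => ?_⟩⟩
  · rintro ⟨l, hl, hp⟩ M hM w hw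
    exact sat_imp.mp (sound _ hp M hM w) (sat_conj.mpr fun ψ hψ => hw ψ (hl ψ hψ))
  · by_contra hnd
    obtain ⟨Δ, hsub, hΔ⟩ := (consistent_insert_neg hnd).exists_maxConsistent
    have hex : ∃ Δ : Set (DynForm At Ob f P), MaxConsistent (GroupAxioms At Ob f P) Δ := ⟨Δ, hΔ⟩
    -- Membership in the class comes before truth of dynamic formulas, since the next step applies
    -- soundness to this model.
    have hM : canonicalModel _ _ hex ∈ ModelClass At Ob f P := by
      refine mem_ModelClass_iff.mpr fun χ hχ T => (sat_canonicalModel_iff hex χ T).mpr ?_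
      obtain ⟨_, Δ', hΔ', rfl⟩ := T
      exact hΔ'.mem_of_provable (.group hχ)
    -- The truth lemma, in one direction, for dynamic formulas: pass to a static equivalent inside
    -- `Δ`, then return by validity of the equivalence.
    have key : ∀ ψ ∈ Δ, ψ.Sat (canonicalModel _ _ hex) ⟨_, Δ, hΔ, rfl⟩ := by
      intro ψ hψ
      obtain ⟨χ, hχ⟩ := exists_static (Γ := GroupAxioms At Ob f P) ψ
      exact (sat_iff.mp (sound _ hχ _ hM _)).mpr <| sat_ofForm.mpr <|
        (sat_canonicalModel_iff hex χ _).mpr (hΔ.mem_of_imp hχ.imp_of_iff hψ)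
    -- The world of `Δ` satisfies `Φ`, hence `φ`, and also `neg φ`.
    exact key (neg φ) (hsub (Set.mem_insert _ _))
      (hc _ hM _ fun ψ hψ => key ψ (hsub (Set.mem_insert_of_mem _ hψ)))
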